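/- **Theorem (Geometric sector decomposition).** Let $n\ge 1$ and let $(a_i)_i$, $(b_j)_j$ be finite families of non-zero homogeneous polynomials in $\mathbb{C}[x_1,\dots,x_n]$. Let $\nu_i,\rho_j\in\mathbb{C}$ satisfy $\operatorname{Re}\nu_i\ge 0$, $\operatorname{Re}\rho_j\ge 0$ and $\sum_i\nu_i\deg a_i=\sum_j\rho_j\deg b_j$. For a polynomial $p\neq 0$ with support $\operatorname{supp}(p)$ (the set of exponent vectors of its non-zero coefficients) let $\mathbf N_p=\operatorname{conv}(\operatorname{supp}(p))\subset\mathbb{R}^n$ be its Newton polytope and $p^{\mathrm{tr}}(x)=\max_{\ell\in\operatorname{supp}(p)}x^\ell$ for $x\in\mathbb{R}^n_{>0}$. Define the weighted Minkowski sums $\mathcal A=\sum_i(\operatorname{Re}\nu_i)\mathbf N_{a_i}$ and $\mathcal B=\sum_j(\operatorname{Re}\rho_j)\mathbf N_{b_j}$, and assume * **R1**: $\mathcal B$ is $(n-1)$-dimensional; * **R2**: $\mathcal A$ is contained in the relative interior of $\mathcal B$. Write $\mathbb 1=(1,\dots,1)\in\mathbb{R}^n$. A fan is a finite family of polyhedral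 cones, closed under taking non-empty faces, in which the intersection of any two cones is a face of both. A fan refines a family of cones if every cone of the family is a union of cones of the fan. The normal fan of a polytope $\mathcal P$ consists of the cones $\{y:\langle y,v\rangle=\max_{w\in\mathcal P}\langle y,w\rangle\ \forall v\in F\}$, for the non-empty faces $F$ of $\mathcal P$. The common refinement of two fans consists of the pairwise intersections of their cones. The reduced common normal fan of $\mathcal A$ and $\mathcal B$ consists of the images in $\mathbb{R}^n/\mathbb 1\mathbb{R}$ of the cones of the common refinement of their normal fans. Let $\mathcal F^\Delta$ be any fan in $\mathbb{R}^n/\mathbb 1\mathbb{R}$ that refines this reduced common normal fan and all of whose cones are simplicial (generated by linearly independent vectors), and let $\mathcal M^\Delta\subset\mathcal F^\Delta$ be the set of its cones of maximal dimension. For every $\mathcal C\in\mathcal M^\Delta$ there are vectors $u^{(\mathcal C,1)},\dots,u^{(\mathcal C,n-1)}\in\mathbb{R}^n$ whose classes in $\mathbb{R}^n/\mathbb 1\mathbb{R}$ generate $\mathcal C$, i.e. $\mathcal C=\{\sum_{k=1}^{n-1}\lambda_k u^{(\mathcal C,k)}:\lambda_k\ge 0\}$, and points $w_{\mathcal A}^{(\mathcal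 C)}\in\mathcal A$, $w_{\mathcal B}^{(\mathcal C)}\in\mathcal B$ such that $\langle y,w_{\mathcal A}^{(\mathcal C)}\rangle=\max_{v\in\mathcal A}\langle y,v\rangle$ and $\langle y,w_{\mathcal B}^{(\mathcal C)}\rangle=\max_{v\in\mathcal B}\langle y,v\rangle$ for all $y\in\mathbb{R}^n$ whose class lies in $\mathcal C$. For every such choice, put $w^{(\mathcal C)}=w_{\mathcal B}^{(\mathcal C)}-w_{\mathcal A}^{(\mathcal C)}$ and $$x^{(\mathcal C)}_k(\xi)=\prod_{i=1}^{n-1}\xi_i^{-u^{(\mathcal C,i)}_k/\langle u^{(\mathcal C,i)},w^{(\mathcal C)}\rangle}\quad(1\le k\le n).$$ Then: 1. For each $\mathcal C\in\mathcal M^\Delta$ the prefactor $$P_{\mathcal C}=\frac{\left|\det(u^{(\mathcal C,1)},\dots,u^{(\mathcal C,n-1)},\mathbb 1)\right|}{\prod_{k=1}^{n-1}\langle u^{(\mathcal C,k)},w^{(\mathcal C)}\rangle}$$ is finite and positive, and $x^{(\mathcal C)}(\xi)\in\operatorname{Exp}(\mathcal C)$ for all $\xi\in(0,1]^{n-1}$,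 where $\operatorname{Exp}(\mathcal C)$ is the set of all $(e^{y_1},\dots,e^{y_n})$ with $y\in\mathbb{R}^n$ of class in $\mathcal C$. 2. Let $f$ be a measurable function $\mathbb{R}^n_{>0}\to\mathbb{C}$, homogeneous of degree $0$, i.e. a measurable function on the positive projective simplex $\mathbb{P}^{n-1}_{>0}=\{[x_1:\dots:x_n]:x_k>0\}$. Let $\Omega=\sum_{k=1}^n(-1)^{n-k}\frac{dx_1}{x_1}\wedge\dots\wedge\widehat{\frac{dx_k}{x_k}}\wedge\dots\wedge\frac{dx_n}{x_n}$, where integrals over $\mathbb{P}^{n-1}_{>0}$ are taken by pulling back along the chart $(x_1,\dots,x_{n-1})\mapsto[x_1:\dots:x_{n-1}:1]$ of $\mathbb{R}^{n-1}_{>0}$ with its standard orientation. The integral $$I[f]=\int_{\mathbb{P}^{n-1}_{>0}}\frac{\prod_i a_i^{\mathrm{tr}}(x)^{\operatorname{Re}\nu_i}}{\prod_j b_j^{\mathrm{tr}}(x)^{\operatorname{Re}\rho_j}}\,f(x)\,\Omega$$ converges absolutely if and only if $\int_{[0,1]^{n-1}}f(x^{(\mathcal C)}(\xi))\,d\xi$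 converges absolutely for every $\mathcal C\in\mathcal M^\Delta$, and in that case $$I[f]=\sum_{\mathcal C\in\mathcal M^\Delta}P_{\mathcal C}\int_{[0,1]^{n-1}}f\bigl(x^{(\mathcal C)}(\xi)\bigr)\,d\xi .$$ -/

import Mathlib

open MeasureTheory Set

noncomputable section

namespace TropicalSector

/-! ### Polyhedral geometry in a real vector space -/

section Geometry

variable {V : Type*} [AddCommGroup V] [Module ℝ V]

/-- `F` is a (possibly empty) face of `P`: for some linear form `y` and scalar `c`, the set `P` lies
in the half-space `y ≤ c` and `F` is its intersection with the hyperplane `y = c`. -/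
def IsFace (P F : Set V) : Prop :=
  ∃ (y : Module.Dual ℝ V) (c : ℝ), (∀ v ∈ P, y v ≤ c) ∧ F = {v | v ∈ P ∧ y v = c}

/-- The cone of all combinations of `u 0, …, u (m - 1)` with non-negative coefficients. -/
def coneHull {m : ℕ} (u : Fin m → V) : Set V :=
  {y | ∃ c : Fin m → ℝ, (∀ k, 0 ≤ c k) ∧ y = ∑ k, c k • u k}

/-- A polyhedral cone: the cone generated by finitely many vectors. -/
def IsPolyhedralCone (C : Set V) : Prop :=
  ∃ K : PointedCone ℝ V, K.FG ∧ C = (K : Set V)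

/-- A simplicial cone: the cone generated by finitely many linearly independent vectors. -/
def IsSimplicialCone (C : Set V) : Prop :=
  ∃ K : PointedCone ℝ V, K.IsSimplicial ∧ C = (K : Set V)

/-- A fan: a finite family of polyhedral cones, closed under taking (non-empty) faces, in which any
two cones intersect in a common face. -/
structure IsFan (F : Set (Set V)) : Prop where
  finite : F.Finite
  cone : ∀ C ∈ F, IsPolyhedralCone C
  face_mem : ∀ C ∈ F, ∀ G, IsFace C G → G.Nonempty → G ∈ F
  inter_face : ∀ C ∈ F, ∀ C' ∈ F, IsFace C (C ∩ C') ∧ IsFace C' (C ∩ C')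

/-- `F'` refines `F`: every cone of `F` is a union of cones of `F'`. -/
def Refines (F' F : Set (Set V)) : Prop :=
  ∀ C ∈ F, ∃ S ⊆ F', C = ⋃₀ S

/-- `F'` is a simplicial refinement of `F`: a fan that refines `F` and whose cones are simplicial. -/
structure IsSimplicialRefinement (F' F : Set (Set V)) : Prop where
  fan : IsFan F'
  refines : Refines F' F
  simplicial : ∀ C ∈ F', IsSimplicialCone C

/-- The common refinement of two families of cones. -/
def commonRefinement (F G : Set (Set V)) : Set (Set V) :=
  {C | ∃ C₁ ∈ F, ∃ C₂ ∈ G, C = C₁ ∩ C₂}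

/-- The dimension of a cone: the dimension of its linear span. -/
def coneDim (C : Set V) : ℕ := Module.finrank ℝ (Submodule.span ℝ C)

/-- The maximal cones of a fan: its cones of maximal dimension. -/
def maximalCones (F : Set (Set V)) : Set (Set V) :=
  {C | C ∈ F ∧ ∀ C' ∈ F, coneDim C' ≤ coneDim C}

end Geometry

/-! ### Normal fans in `ℝⁿ` and in `ℝⁿ / 𝟙ℝ` -/

/-- `w ∈ P` and `⟨y, w⟩ = max_{v ∈ P} ⟨y, v⟩`. -/
def IsMaximizer {n : ℕ} (P : Set (Fin n → ℝ)) (y w : Fin n → ℝ) : Prop :=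
  w ∈ P ∧ IsGreatest ((fun v => y ⬝ᵥ v) '' P) (y ⬝ᵥ w)

/-- The normal cone of a face `F` of `P`. -/
def normalCone {n : ℕ} (P F : Set (Fin n → ℝ)) : Set (Fin n → ℝ) :=
  {y | ∀ v ∈ F, IsMaximizer P y v}

/-- The normal fan of `P`: the normal cones of its non-empty faces. -/
def normalFan {n : ℕ} (P : Set (Fin n → ℝ)) : Set (Set (Fin n → ℝ)) :=
  {C | ∃ F, IsFace P F ∧ F.Nonempty ∧ C = normalCone P F}

/-- The quotient `ℝⁿ / 𝟙ℝ`, where `𝟙 = (1, …, 1)`. -/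
abbrev TropProj (n : ℕ) : Type :=
  (Fin n → ℝ) ⧸ (Submodule.span ℝ {(1 : Fin n → ℝ)})

/-- The class in `ℝⁿ / 𝟙ℝ` of a vector in `ℝⁿ`. -/
def toTropProj {n : ℕ} (y : Fin n → ℝ) : TropProj n :=
  (Submodule.span ℝ {(1 : Fin n → ℝ)}).mkQ y

/-- The common refinement of the normal fans of `A` and `B`, reduced modulo `𝟙ℝ`. -/
def reducedCommonNormalFan {n : ℕ} (A B : Set (Fin n → ℝ)) : Set (Set (TropProj n)) :=
  (fun C => toTropProj '' C) '' commonRefinement (normalFan A) (normalFan B)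

/-! ### Polynomials, Newton polytopes, tropical approximation -/

/-- The Newton polytope: the convex hull in `ℝⁿ` of the exponent vectors in the support. -/
def newtonPolytope {n : ℕ} (p : MvPolynomial (Fin n) ℂ) : Set (Fin n → ℝ) :=
  convexHull ℝ ((fun (l : Fin n →₀ ℕ) (k : Fin n) => (l k : ℝ)) '' (p.support : Set (Fin n →₀ ℕ)))

/-- The weighted Minkowski sum `∑ i, (Re ν i) NP(a i)` of Newton polytopes. -/
def weightedNewtonSum {n : ℕ} {ι : Type*} [Fintype ι]
    (a : ι → MvPolynomial (Fin n) ℂ) (ν : ι → ℂ) : Set (Fin n → ℝ) :=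
  {v | ∃ p : ι → Fin n → ℝ, (∀ i, p i ∈ newtonPolytope (a i)) ∧ v = ∑ i, (ν i).re • p i}

/-- The tropical approximation `p^tr(x) = max_{l ∈ supp p} x^l` (used for `p ≠ 0`). -/
def tropicalApprox {n : ℕ} (p : MvPolynomial (Fin n) ℂ) (x : Fin n → ℝ) : ℝ :=
  sSup ((fun l : Fin n →₀ ℕ => ∏ k, x k ^ l k) '' (p.support : Set (Fin n →₀ ℕ)))

/-- `∏ i, a_i^tr(x)^(Re ν_i) / ∏ j, b_j^tr(x)^(Re ρ_j)`. -/
def tropicalIntegrand {n : ℕ} {ι κ : Type*} [Fintype ι] [Fintype κ]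
    (a : ι → MvPolynomial (Fin n) ℂ) (ν : ι → ℂ) (b : κ → MvPolynomial (Fin n) ℂ) (ρ : κ → ℂ)
    (x : Fin n → ℝ) : ℝ :=
  (∏ i, tropicalApprox (a i) x ^ (ν i).re) / ∏ j, tropicalApprox (b j) x ^ (ρ j).re

/-! ### Integration over the positive projective simplex

With `n = d + 1` homogeneous coordinates, functions on the positive projective simplex are functions
on the positive orthant of `ℝⁿ` that are homogeneous of degree `0`. -/

/-- The open positive orthant. -/
def posOrthant (n : ℕ) : Set (Fin n → ℝ) := {x | ∀ k, 0 < x k}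

/-- A measurable function on the positive orthant that is homogeneous of degree `0`. -/
structure IsMeasurableHomogeneous {n : ℕ} (f : (Fin n → ℝ) → ℂ) : Prop where
  measurable : Measurable fun x : posOrthant n => f x
  homogeneous : ∀ x ∈ posOrthant n, ∀ c : ℝ, 0 < c → f (c • x) = f x

/-- The value at the point `x`, on the tangent vectors `v 0, …, v (d - 1)`, of the form
`Ω = ∑ k, (-1)^(n - k) dx₁/x₁ ∧ … ∧ (omit dx_k/x_k) ∧ … ∧ dxₙ/xₙ`, where `n = d + 1`
(the index `k` runs from `1` in this formula and from `0` in the code). -/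
def canonicalForm {d : ℕ} (x : Fin (d + 1) → ℝ) (v : Fin d → Fin (d + 1) → ℝ) : ℝ :=
  ∑ k : Fin (d + 1), (-1 : ℝ) ^ (d - (k : ℕ)) *
    (Matrix.of fun i j : Fin d => v j (k.succAbove i) / x (k.succAbove i)).det

/-- The affine chart `(t₁, …, t_d) ↦ [t₁ : … : t_d : 1]`, a diffeomorphism from the positive orthant
of `ℝ^d` onto the positive projective simplex. -/
def affineChart {d : ℕ} (t : Fin d → ℝ) : Fin (d + 1) → ℝ :=
  Fin.snoc (α := fun _ => ℝ) t 1

/-- The coefficient of `dt₁ ∧ … ∧ dt_d` in the pullback of `Ω` along the affine chart. -/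
def chartDensity {d : ℕ} (t : Fin d → ℝ) : ℝ :=
  canonicalForm (affineChart t) fun j => fderiv ℝ affineChart t (Pi.single j 1)

/-- The form `g Ω` is absolutely integrable over the positive projective simplex. -/
def ProjIntegrable {d : ℕ} (g : (Fin (d + 1) → ℝ) → ℂ) : Prop :=
  IntegrableOn (fun t => g (affineChart t) * (chartDensity t : ℂ)) (posOrthant d) volume

/-- The integral of the form `g Ω` over the positive projective simplex. -/
def projIntegral {d : ℕ} (g : (Fin (d + 1) → ℝ) → ℂ) : ℂ :=
  ∫ t in posOrthant d, g (affineChart t) * (chartDensity t : ℂ)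

/-! ### Sector data -/

/-- The points of the positive orthant representing `Exp(C)`, for `C ⊆ ℝⁿ / 𝟙ℝ`. -/
def expCone {n : ℕ} (C : Set (TropProj n)) : Set (Fin n → ℝ) :=
  {x | ∃ y : Fin n → ℝ, toTropProj y ∈ C ∧ x = fun k => Real.exp (y k)}

/-- `|det(u⁽¹⁾, …, u⁽ᵈ⁾, 𝟙)| / ∏ k, ⟨u⁽ᵏ⁾, w⟩`, the determinant being that of the matrix with the
indicated columns. -/
def sectorPrefactor {d : ℕ} (u : Fin d → Fin (d + 1) → ℝ) (w : Fin (d + 1) → ℝ) : ℝ :=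
  |(Matrix.of fun i j : Fin (d + 1) =>
      Fin.snoc (α := fun _ => Fin (d + 1) → ℝ) u (fun _ => 1) j i).det| / ∏ k, u k ⬝ᵥ w

/-- The point with coordinates `x_k = ∏ i, ξ_i ^ (-u_k⁽ⁱ⁾ / ⟨u⁽ⁱ⁾, w⟩)`. -/
def sectorPoint {d : ℕ} (u : Fin d → Fin (d + 1) → ℝ) (w : Fin (d + 1) → ℝ) (ξ : Fin d → ℝ) :
    Fin (d + 1) → ℝ :=
  fun k => ∏ i, ξ i ^ (-(u i k) / (u i ⬝ᵥ w))

/-- `u⁽¹⁾, …, u⁽ᵈ⁾` represent vectors of `ℝⁿ / 𝟙ℝ` that generate the cone `C`. -/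
def Generates {d : ℕ} (C : Set (TropProj (d + 1))) (u : Fin d → Fin (d + 1) → ℝ) : Prop :=
  C = coneHull fun k => toTropProj (u k)

/-- `w ∈ P` maximizes `⟨y, ·⟩` on `P` simultaneously for all `y ∈ C`. -/
def MaximizesOn {n : ℕ} (C : Set (TropProj n)) (P : Set (Fin n → ℝ)) (w : Fin n → ℝ) : Prop :=
  w ∈ P ∧ ∀ y : Fin n → ℝ, toTropProj y ∈ C → IsMaximizer P y w

end TropicalSector

end

/-! In logarithmic coordinates `x = exp y`, the form `Ω` becomes Lebesgue measure on `ℝⁿ / 𝟙ℝ ≅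
ℝ^d`. The tropical factor becomes the exponential of the support function of `A` minus that of `B`
(`IsMaximizer.prod_tropicalApprox`). Support functions are linear on normal cones, so on each cone
of `Δ` this factor is `exp (-⟨y, w⟩)` with `w = wB - wA`.

Normal fans of polytopes are complete, hence so is `Δ`. Its maximal cones are the full-dimensional
ones, and they tile space up to null sets (`iUnion_maximalCones_ae_eq`, `aedisjoint_maximalCones`).
On a maximal cone write `y = ∑ λ_k u_k` and substitute `ξ_k = exp (-λ_k ⟨u_k, w⟩)`. The cone becomes
the unit cube and the tropical factor becomes `∏ ξ_k`, which cancels the Jacobian up to the constant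
prefactor (`integrableOn_cone_iff`, `integral_cone_eq`).

The substitution needs `⟨u_k, w⟩ > 0`, and this is where R1 and R2 enter: a linear form maximal over
`B` at a relative interior point is constant on `B`, hence a multiple of `𝟙`, so its class vanishes
(`dotProduct_lt_of_mem_intrinsicInterior`). -/

noncomputable section

namespace TropicalSector

/-! ### Fans and simplicial refinements -/

section Fans

variable {V : Type*} [AddCommGroup V] [Module ℝ V]

lemma zero_mem_coneHull {m : ℕ} (u : Fin m → V) : (0 : V) ∈ coneHull u :=
  ⟨0, fun _ => le_rfl, by simp⟩

lemma mem_coneHull_self {m : ℕ} (u : Fin m → V) (k : Fin m) : u k ∈ coneHull u := by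
  refine ⟨Pi.single k 1, fun i => ?_, ?_⟩
  · by_cases h : i = k
    · subst h; simp
    · simp [h]
  · simp [Pi.single_apply]

lemma span_coneHull {m : ℕ} (u : Fin m → V) :
    Submodule.span ℝ (coneHull u) = Submodule.span ℝ (range u) := by
  apply le_antisymm
  · rw [Submodule.span_le]
    rintro _ ⟨c, -, rfl⟩
    exact Submodule.sum_mem _ fun k _ =>
      Submodule.smul_mem _ _ (Submodule.subset_span ⟨k, rfl⟩)
  · apply Submodule.span_mono
    rintro _ ⟨k, rfl⟩
    exact mem_coneHull_self u k

lemma IsSimplicialCone.exists_eq_coneHull {C : Set V} (h : IsSimplicialCone C) :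
    ∃ (m : ℕ) (u : Fin m → V), LinearIndependent ℝ u ∧ C = coneHull u := by
  obtain ⟨K, ⟨s, hs, hli, rfl⟩, rfl⟩ := h
  have := hs.fintype
  let e := (Fintype.equivFin s).symm
  refine ⟨Fintype.card s, fun k => (e k : V), ?_, ?_⟩
  · exact LinearIndependent.comp (v := fun x : s => (x : V)) hli e e.injective
  · have hr : range (fun k => (e k : V)) = s := by
      ext x
      constructor
      · rintro ⟨k, rfl⟩; exact (e k).2
      · intro hx; exact ⟨e.symm ⟨x, hx⟩, by simp⟩
    have hK : PointedCone.hull ℝ s = PointedCone.hull ℝ (range fun k => (e k : V)) := by rw [hr]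
    ext x
    rw [hK, SetLike.mem_coe, PointedCone.hull, Submodule.mem_span_range_iff_exists_fun]
    constructor
    · rintro ⟨c, rfl⟩
      exact ⟨fun k => c k, fun k => (c k).2, rfl⟩
    · rintro ⟨c, hc, rfl⟩
      exact ⟨fun k => ⟨c k, hc k⟩, rfl⟩

/-- A cone meeting another cone of a fan at an interior point is contained in it. -/
lemma coneHull_subset_of_sum_mem {m : ℕ} {u : Fin m → V} {C' : Set V}
    (hf : IsFace (coneHull u) (coneHull u ∩ C')) (h0 : (0 : V) ∈ C') (hp : ∑ k, u k ∈ C') :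
    coneHull u ⊆ C' := by
  obtain ⟨y, c, hle, heq⟩ := hf
  have hc : c = 0 := by
    have : (0 : V) ∈ coneHull u ∩ C' := ⟨zero_mem_coneHull u, h0⟩
    rw [heq] at this
    simpa using this.2.symm
  subst hc
  have hpm : ∑ k, u k ∈ coneHull u ∩ C' := ⟨⟨1, by simp, by simp⟩, hp⟩
  rw [heq] at hpm
  have hsum : ∑ k, y (u k) = 0 := by rw [← map_sum]; exact hpm.2
  -- The supporting form is non-positive on each generator and sums to zero over them, so it
  -- vanishes on the whole cone.
  have hz : ∀ k, y (u k) = 0 := fun k =>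
    (Finset.sum_eq_zero_iff_of_nonpos fun k _ => hle _ (mem_coneHull_self u k)).1 hsum k
      (Finset.mem_univ k)
  rintro v hv
  have : v ∈ coneHull u ∩ C' := by
    rw [heq]
    refine ⟨hv, ?_⟩
    obtain ⟨c, -, rfl⟩ := hv
    simp [hz]
  exact this.2

lemma zero_mem_of_isPolyhedralCone {C : Set V} (h : IsPolyhedralCone C) : (0 : V) ∈ C := by
  obtain ⟨K, -, rfl⟩ := h
  exact K.zero_mem

lemma IsSimplicialRefinement.sUnion_eq_univ {Δ F : Set (Set V)} (h : IsSimplicialRefinement Δ F)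
    (hF : ⋃₀ F = univ) : ⋃₀ Δ = univ := by
  refine eq_univ_of_forall fun x => ?_
  obtain ⟨D, hD, hx⟩ := mem_sUnion.1 (hF ▸ mem_univ x)
  obtain ⟨S, hS, rfl⟩ := h.refines D hD
  obtain ⟨C, hC, hx⟩ := hx
  exact ⟨C, hS hC, hx⟩

/-- The sum of the generators of `C` is a relative interior point. It lies in some `D ∈ F`, hence in
a cone of `Δ` contained in `D`, and that cone must contain all of `C`. -/
lemma IsSimplicialRefinement.exists_superset {Δ F : Set (Set V)}
    (h : IsSimplicialRefinement Δ F) (hF : ⋃₀ F = univ) {C : Set V} (hC : C ∈ Δ) :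
    ∃ D ∈ F, C ⊆ D := by
  obtain ⟨m, u, -, rfl⟩ := (h.simplicial C hC).exists_eq_coneHull
  obtain ⟨D, hD, hp⟩ := mem_sUnion.1 (hF ▸ mem_univ (∑ k, u k))
  obtain ⟨S, hS, rfl⟩ := h.refines D hD
  obtain ⟨C', hC', hp⟩ := hp
  refine ⟨_, hD, (coneHull_subset_of_sum_mem (h.fan.inter_face _ hC _ (hS hC')).1
    (zero_mem_of_isPolyhedralCone (h.fan.cone _ (hS hC'))) hp).trans (subset_sUnion_of_mem hC')⟩

/-- Distinct cones of a fan meet in a proper subspace unless one is contained in the other. -/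
lemma IsFan.subset_or_inter_subset {Δ : Set (Set V)} (h : IsFan Δ) {C C' : Set V} (hC : C ∈ Δ)
    (hC' : C' ∈ Δ) : C ⊆ C' ∨ ∃ W : Submodule ℝ V, W ≠ ⊤ ∧ C ∩ C' ⊆ W := by
  obtain ⟨y, c, hle, heq⟩ := (h.inter_face C hC C' hC').1
  have hc : c = 0 := by
    have : (0 : V) ∈ C ∩ C' := ⟨zero_mem_of_isPolyhedralCone (h.cone _ hC),
      zero_mem_of_isPolyhedralCone (h.cone _ hC')⟩
    rw [heq] at this
    simpa using this.2.symm
  subst hc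
  -- A zero supporting form means that the common face is all of `C`; otherwise its kernel is a
  -- proper subspace containing the face.
  by_cases hy : y = 0
  · left
    intro v hv
    have : v ∈ C ∩ C' := by rw [heq]; exact ⟨hv, by simp [hy]⟩
    exact this.2
  · right
    refine ⟨LinearMap.ker y, fun h => hy (LinearMap.ker_eq_top.1 h), ?_⟩
    rw [heq]
    exact fun v hv => hv.2

lemma IsFan.exists_inter_subset {Δ : Set (Set V)} (h : IsFan Δ) {C C' : Set V} (hC : C ∈ Δ)
    (hC' : C' ∈ Δ) (hne : C ≠ C') : ∃ W : Submodule ℝ V, W ≠ ⊤ ∧ C ∩ C' ⊆ W := by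
  rcases h.subset_or_inter_subset hC hC' with h1 | h1
  · rcases h.subset_or_inter_subset hC' hC with h2 | h2
    · exact absurd (h1.antisymm h2) hne
    · rwa [inter_comm]
  · exact h1

/-- A real vector space is not a finite union of proper subspaces. -/
lemma IsFan.exists_span_eq_top {Δ : Set (Set V)} (h : IsFan Δ) (hU : ⋃₀ Δ = univ) :
    ∃ C ∈ Δ, Submodule.span ℝ C = ⊤ := by
  by_contra! hcon
  have := h.finite.fintype
  refine Subspace.biUnion_ne_univ_of_top_notMem (k := ℝ) (E := V)
    (s := (Δ.toFinset.image (Submodule.span ℝ))) ?_ ?_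
  · simpa using hcon
  · refine eq_univ_of_forall fun x => ?_
    obtain ⟨C, hC, hx⟩ := mem_sUnion.1 (hU ▸ mem_univ x)
    simp only [mem_iUnion]
    exact ⟨Submodule.span ℝ C, by simpa using ⟨C, hC, rfl⟩, Submodule.subset_span hx⟩

lemma IsFan.mem_maximalCones_iff [FiniteDimensional ℝ V] {Δ : Set (Set V)} (h : IsFan Δ) (hU : ⋃₀ Δ = univ) {C : Set V} :
    C ∈ maximalCones Δ ↔ C ∈ Δ ∧ Submodule.span ℝ C = ⊤ := by
  refine ⟨fun hC => ⟨hC.1, ?_⟩, fun hC => ⟨hC.1, fun C' _ => ?_⟩⟩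
  · obtain ⟨C', hC', ht⟩ := h.exists_span_eq_top hU
    have := hC.2 C' hC'
    rw [coneDim, ht, finrank_top] at this
    exact Submodule.eq_top_of_finrank_eq (le_antisymm (Submodule.finrank_le _) this)
  · rw [coneDim, coneDim, hC.2, finrank_top]
    exact Submodule.finrank_le _

lemma linearIndependent_of_span_coneHull {m : ℕ} {u : Fin m → V} (hm : Module.finrank ℝ V = m)
    (h : Submodule.span ℝ (coneHull u) = ⊤) : LinearIndependent ℝ u := by
  rw [span_coneHull] at h
  exact linearIndependent_of_top_le_span_of_card_eq_finrank h.ge (by simp [hm])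

lemma exists_generators_of_span_eq_top {m : ℕ} (hm : Module.finrank ℝ V = m) {C : Set V}
    (hC : IsSimplicialCone C) (h : Submodule.span ℝ C = ⊤) : ∃ u : Fin m → V, C = coneHull u := by
  obtain ⟨m', u, hu, rfl⟩ := hC.exists_eq_coneHull
  have : m' = m := by
    rw [span_coneHull] at h
    have := finrank_span_eq_card hu
    rw [h, finrank_top, hm] at this
    simpa using this.symm
  subst this
  exact ⟨u, rfl⟩

end Fans

/-! ### Affine coordinates on `ℝⁿ / 𝟙ℝ` and the density of `Ω` -/

section Charts

variable {d : ℕ}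

lemma affineChart_castSucc (t : Fin d → ℝ) (i : Fin d) : affineChart t i.castSucc = t i := by
  simp [affineChart]

lemma fderiv_affineChart (t v : Fin d → ℝ) :
    fderiv ℝ affineChart t v = Fin.snoc (α := fun _ => ℝ) v 0 := by
  have h : HasFDerivAt (affineChart (d := d)) (ContinuousLinearMap.pi fun k =>
      Fin.lastCases (motive := fun _ => (Fin d → ℝ) →L[ℝ] ℝ) 0
        (fun i => ContinuousLinearMap.proj i) k) t := by
    rw [hasFDerivAt_pi]
    intro k
    induction k using Fin.lastCases with
    | last => simpa [affineChart] using hasFDerivAt_const (1 : ℝ) t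
    | cast i =>
      simpa [affineChart] using hasFDerivAt_apply (𝕜 := ℝ) i t
  rw [h.fderiv]
  ext k
  induction k using Fin.lastCases with
  | last => simp
  | cast i => simp

/-- The last homogeneous coordinate is constant along the chart, so every summand of `Ω` containing
its differential has a zero row; only the summand omitting it survives. -/
lemma chartDensity_eq (t : Fin d → ℝ) : chartDensity t = ∏ i, (t i)⁻¹ := by
  rw [chartDensity, canonicalForm, Fin.sum_univ_castSucc, Finset.sum_eq_zero, zero_add]
  · have : (Matrix.of fun i j : Fin d => fderiv ℝ affineChart t (Pi.single j 1)
        ((Fin.last d).succAbove i) / affineChart t ((Fin.last d).succAbove i)) =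
        Matrix.diagonal fun i => (t i)⁻¹ := by
      ext i j
      rw [Matrix.of_apply, Fin.succAbove_last, fderiv_affineChart, affineChart_castSucc,
        Fin.snoc_castSucc, Matrix.diagonal_apply]
      split_ifs with h
      · subst h; simp
      · simp [h]
    rw [this]
    simp
  · intro k _
    obtain ⟨i, hi⟩ := Fin.exists_succAbove_eq (Fin.castSucc_lt_last k).ne'
    rw [Matrix.det_eq_zero_of_row_eq_zero i, mul_zero]
    intro j
    rw [Matrix.of_apply, hi, fderiv_affineChart, Fin.snoc_last, zero_div]

/-- The affine coordinates `y_j - y_n` on `ℝⁿ / 𝟙ℝ`. -/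
def affineCoord (d : ℕ) : (Fin (d + 1) → ℝ) →ₗ[ℝ] (Fin d → ℝ) where
  toFun y j := y j.castSucc - y (Fin.last d)
  map_add' _ _ := funext fun _ => add_sub_add_comm _ _ _ _
  map_smul' _ _ := funext fun _ => (mul_sub _ _ _).symm

@[simp]
lemma affineCoord_apply (y : Fin (d + 1) → ℝ) (j : Fin d) :
    affineCoord d y j = y j.castSucc - y (Fin.last d) := rfl

lemma affineCoord_snoc (s : Fin d → ℝ) :
    affineCoord d (Fin.snoc (α := fun _ => ℝ) s 0) = s := by
  ext j; simp

lemma ker_affineCoord : LinearMap.ker (affineCoord d) = Submodule.span ℝ {1} := by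
  ext y
  rw [LinearMap.mem_ker, Submodule.mem_span_singleton]
  constructor
  · intro h
    refine ⟨y (Fin.last d), funext fun k => ?_⟩
    induction k using Fin.lastCases with
    | last => simp
    | cast i =>
      have := congrFun h i
      simp only [affineCoord_apply, Pi.zero_apply] at this
      simp only [Pi.smul_apply, Pi.one_apply, smul_eq_mul, mul_one]
      linarith
  · rintro ⟨c, rfl⟩
    ext j; simp

/-- `ℝⁿ / 𝟙ℝ` is identified with `ℝ^(n-1)` by the affine coordinates. -/
def tropProjEquiv (d : ℕ) : TropProj (d + 1) ≃ₗ[ℝ] (Fin d → ℝ) :=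
  (Submodule.quotEquivOfEq _ _ ker_affineCoord.symm).trans
    ((affineCoord d).quotKerEquivOfSurjective fun s => ⟨_, affineCoord_snoc s⟩)

@[simp]
lemma tropProjEquiv_toTropProj (y : Fin (d + 1) → ℝ) :
    tropProjEquiv d (toTropProj y) = affineCoord d y := rfl

lemma finrank_tropProj : Module.finrank ℝ (TropProj (d + 1)) = d := by
  simp [(tropProjEquiv d).finrank_eq]

lemma toTropProj_sum_smul {m : ℕ} (c : Fin m → ℝ) (u : Fin m → Fin (d + 1) → ℝ) :
    toTropProj (∑ k, c k • u k) = ∑ k, c k • toTropProj (u k) := by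
  simp [toTropProj]

lemma toTropProj_eq_iff {n : ℕ} {y y' : Fin n → ℝ} :
    toTropProj y = toTropProj y' ↔ ∃ c : ℝ, y = y' + c • 1 := by
  rw [toTropProj, toTropProj, Submodule.mkQ_apply, Submodule.mkQ_apply, Submodule.Quotient.eq,
    Submodule.mem_span_singleton]
  constructor
  · rintro ⟨c, h⟩; exact ⟨c, by rw [h]; abel⟩
  · rintro ⟨c, h⟩; exact ⟨c, by rw [h]; abel⟩

lemma toTropProj_surjective {n : ℕ} : Function.Surjective (toTropProj (n := n)) :=
  Submodule.mkQ_surjective _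

/-- Subtracting the last row from the others turns the column `𝟙` into the last unit vector; then
expand along that column. -/
lemma det_snoc_one (u : Fin d → Fin (d + 1) → ℝ) :
    (Matrix.of fun i j : Fin (d + 1) =>
      Fin.snoc (α := fun _ => Fin (d + 1) → ℝ) u (fun _ => 1) j i).det =
    (Matrix.of fun j i : Fin d => affineCoord d (u i) j).det := by
  rw [← Matrix.det_eq_of_forall_row_eq_smul_add_const
    (A := Matrix.of fun i j : Fin (d + 1) => Fin.lastCases (motive := fun _ => ℝ)
      (Fin.snoc (α := fun _ => Fin (d + 1) → ℝ) u (fun _ => 1) j (Fin.last d))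
      (fun i => Fin.snoc (α := fun _ => Fin (d + 1) → ℝ) u (fun _ => 1) j i.castSucc -
        Fin.snoc (α := fun _ => Fin (d + 1) → ℝ) u (fun _ => 1) j (Fin.last d)) i)
    (Fin.lastCases (motive := fun _ => ℝ) 0 (fun _ => -1)) (Fin.last d) (by simp) ?_]
  · rw [Matrix.det_succ_column _ (Fin.last d), Fin.sum_univ_castSucc, Finset.sum_eq_zero]
    · have h2 : (-1 : ℝ) ^ (d + d) = 1 := Even.neg_one_pow ⟨d, rfl⟩
      simp only [Matrix.of_apply, Fin.lastCases_last, Fin.snoc_last, Fin.val_last, h2, zero_add,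
        one_mul, Fin.succAbove_last]
      congr 1
      ext i j
      simp
    · intro i _
      simp
  · intro i j
    induction i using Fin.lastCases with
    | last => simp
    | cast i => simp [sub_eq_add_neg]

end Charts

/-! ### Logarithmic coordinates and the map from the unit cube to a simplicial cone -/

section ChangeOfVariables

variable {d : ℕ}

lemma hasFDerivAt_toLin' {F : (Fin d → ℝ) → Fin d → ℝ} {M : Matrix (Fin d) (Fin d) ℝ}
    {x : Fin d → ℝ} (h : ∀ j, HasFDerivAt (fun x => F x j)
      (∑ i, M j i • (ContinuousLinearMap.proj i : (Fin d → ℝ) →L[ℝ] ℝ)) x) :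
    HasFDerivAt F (LinearMap.toContinuousLinearMap (Matrix.toLin' M)) x := by
  rw [hasFDerivAt_pi']
  intro j
  refine (h j).congr_fderiv ?_
  ext v
  simp [Matrix.mulVec, dotProduct]

lemma det_toContinuousLinearMap_toLin' (M : Matrix (Fin d) (Fin d) ℝ) :
    (LinearMap.toContinuousLinearMap (Matrix.toLin' M)).det = M.det := by
  simp [ContinuousLinearMap.det]

lemma image_exp_univ :
    (fun (s : Fin d → ℝ) i => Real.exp (s i)) '' univ = posOrthant d := by
  ext t
  constructor
  · rintro ⟨s, -, rfl⟩ i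
    exact Real.exp_pos _
  · intro ht
    exact ⟨fun i => Real.log (t i), trivial, funext fun i => Real.exp_log (ht i)⟩

lemma hasFDerivAt_exp_pi (s : Fin d → ℝ) :
    HasFDerivAt (fun (s : Fin d → ℝ) i => Real.exp (s i)) (LinearMap.toContinuousLinearMap
      (Matrix.toLin' (Matrix.diagonal fun i => Real.exp (s i)))) s := by
  refine hasFDerivAt_toLin' fun j => ?_
  refine (hasFDerivAt_apply (𝕜 := ℝ) j s).exp.congr_fderiv ?_
  simp [Matrix.diagonal_apply]

lemma exp_pi_injective : Function.Injective (fun (s : Fin d → ℝ) i => Real.exp (s i)) :=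
  fun _ _ h => funext fun i => Real.exp_injective (congrFun h i)

/-- The Jacobian `∏ exp (s i)` of the coordinatewise exponential is the inverse of the chart
density. -/
lemma exp_density_smul (g : (Fin (d + 1) → ℝ) → ℂ) (s : Fin d → ℝ) :
    |(LinearMap.toContinuousLinearMap
      (Matrix.toLin' (Matrix.diagonal fun i => Real.exp (s i)))).det| •
      (g (affineChart fun i => Real.exp (s i)) * (chartDensity fun i => Real.exp (s i) : ℂ)) =
    g (affineChart fun i => Real.exp (s i)) := by
  have hpos : (0 : ℝ) < ∏ i, Real.exp (s i) := Finset.prod_pos fun i _ => Real.exp_pos _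
  rw [det_toContinuousLinearMap_toLin', Matrix.det_diagonal, chartDensity_eq, abs_of_pos hpos,
    Finset.prod_inv_distrib, Complex.real_smul, mul_left_comm, ← Complex.ofReal_mul,
    mul_inv_cancel₀ hpos.ne']
  simp

/-- Integrability of `g Ω` in logarithmic affine coordinates. -/
lemma projIntegrable_iff (g : (Fin (d + 1) → ℝ) → ℂ) :
    ProjIntegrable g ↔ Integrable fun s : Fin d → ℝ => g (affineChart fun i => Real.exp (s i)) := by
  rw [ProjIntegrable, ← image_exp_univ, integrableOn_image_iff_integrableOn_abs_det_fderiv_smul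
    volume MeasurableSet.univ (fun s _ => (hasFDerivAt_exp_pi s).hasFDerivWithinAt)
    exp_pi_injective.injOn]
  simp only [exp_density_smul, integrableOn_univ]

/-- The integral of `g Ω` in logarithmic affine coordinates. -/
lemma projIntegral_eq (g : (Fin (d + 1) → ℝ) → ℂ) :
    projIntegral g = ∫ s : Fin d → ℝ, g (affineChart fun i => Real.exp (s i)) := by
  rw [projIntegral, ← image_exp_univ, integral_image_eq_integral_abs_det_fderiv_smul
    volume MeasurableSet.univ (fun s _ => (hasFDerivAt_exp_pi s).hasFDerivWithinAt)
    exp_pi_injective.injOn]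
  simp only [exp_density_smul, setIntegral_univ]

/-- The logarithmic coordinates on the cone generated by the columns of `U`. -/
def sectorMap (U : Matrix (Fin d) (Fin d) ℝ) (c ξ : Fin d → ℝ) : Fin d → ℝ :=
  U.mulVec fun i => -Real.log (ξ i) / c i

lemma hasFDerivAt_sectorMap (U : Matrix (Fin d) (Fin d) ℝ) (c : Fin d → ℝ) {ξ : Fin d → ℝ}
    (hξ : ∀ i, 0 < ξ i) :
    HasFDerivAt (sectorMap U c) (LinearMap.toContinuousLinearMap
      (Matrix.toLin' (U * Matrix.diagonal fun i => -(ξ i)⁻¹ / c i))) ξ := by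
  refine hasFDerivAt_toLin' fun j => ?_
  have : (fun ξ => sectorMap U c ξ j) = fun ξ => ∑ i, (-U j i / c i) * Real.log (ξ i) := by
    funext ξ
    simp only [sectorMap, Matrix.mulVec, dotProduct]
    exact Finset.sum_congr rfl fun i _ => by ring
  rw [this]
  refine HasFDerivAt.fun_sum fun i _ => ?_
  refine (((hasFDerivAt_apply (𝕜 := ℝ) i ξ).log (hξ i).ne').const_mul
    (-U j i / c i)).congr_fderiv ?_
  rw [Matrix.mul_diagonal, smul_smul]
  congr 1
  ring

lemma sectorMap_injOn {U : Matrix (Fin d) (Fin d) ℝ} (hU : U.det ≠ 0) {c : Fin d → ℝ}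
    (hc : ∀ i, 0 < c i) : InjOn (sectorMap U c) (univ.pi fun _ => Ioc (0 : ℝ) 1) := by
  intro ξ hξ η hη h
  have := Matrix.mulVec_injective_of_isUnit ((Matrix.isUnit_iff_isUnit_det _).2 hU.isUnit) h
  funext i
  have hi := congrFun this i
  simp only [div_left_inj' (hc i).ne', neg_inj] at hi
  exact Real.log_injOn_pos (hξ i trivial).1 (hη i trivial).1 hi

lemma image_sectorMap (U : Matrix (Fin d) (Fin d) ℝ) {c : Fin d → ℝ} (hc : ∀ i, 0 < c i) :
    sectorMap U c '' (univ.pi fun _ => Ioc (0 : ℝ) 1) =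
      {s | ∃ l : Fin d → ℝ, (∀ i, 0 ≤ l i) ∧ s = U.mulVec l} := by
  ext s
  constructor
  · rintro ⟨ξ, hξ, rfl⟩
    exact ⟨_, fun i => div_nonneg (neg_nonneg.2 (Real.log_nonpos (hξ i trivial).1.le
      (hξ i trivial).2)) (hc i).le, rfl⟩
  · rintro ⟨l, hl, rfl⟩
    -- The witness solves `l i = -log (ξ i) / c i`; it is at most `1` exactly because `c i * l i ≥
    -- 0`.
    refine ⟨fun i => Real.exp (-(c i * l i)), fun i _ => ⟨Real.exp_pos _, ?_⟩, ?_⟩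
    · rw [Real.exp_le_one_iff]
      exact neg_nonpos.2 (mul_nonneg (hc i).le (hl i))
    · rw [sectorMap]
      congr 1
      funext i
      rw [Real.log_exp, neg_neg, mul_div_cancel_left₀ _ (hc i).ne']

lemma abs_det_sectorMap (U : Matrix (Fin d) (Fin d) ℝ) {c : Fin d → ℝ} (hc : ∀ i, 0 < c i)
    {ξ : Fin d → ℝ} (hξ : ∀ i, 0 < ξ i) :
    |(LinearMap.toContinuousLinearMap
      (Matrix.toLin' (U * Matrix.diagonal fun i => -(ξ i)⁻¹ / c i))).det| =
      |U.det| / (∏ i, c i) * (∏ i, ξ i)⁻¹ := by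
  rw [det_toContinuousLinearMap_toLin', Matrix.det_mul, Matrix.det_diagonal, abs_mul,
    Finset.abs_prod]
  have : ∀ i, |-(ξ i)⁻¹ / c i| = (ξ i)⁻¹ * (c i)⁻¹ := fun i => by
    rw [abs_div, abs_neg, abs_of_pos (inv_pos.2 (hξ i)), abs_of_pos (hc i), div_eq_mul_inv]
  simp only [this, Finset.prod_mul_distrib, Finset.prod_inv_distrib]
  ring

lemma measurableSet_unitCube : MeasurableSet (univ.pi fun _ : Fin d => Ioc (0 : ℝ) 1) :=
  MeasurableSet.univ_pi fun _ => measurableSet_Ioc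

/-- The logarithm requires `ξ i > 0`, so the substitution is carried out on the half-open cube,
which maps onto the closed cone; the faces left out are null. -/
lemma unitCube_ae_eq : (univ.pi fun _ : Fin d => Ioc (0 : ℝ) 1) =ᵐ[volume] Icc (0 : Fin d → ℝ) 1 :=
  Measure.univ_pi_Ioc_ae_eq_Icc

variable {U : Matrix (Fin d) (Fin d) ℝ} {c : Fin d → ℝ} {h F : (Fin d → ℝ) → ℂ}

lemma abs_det_sectorMap_smul (hc : ∀ i, 0 < c i)
    (hF : ∀ ξ ∈ univ.pi fun _ => Ioc (0 : ℝ) 1, h (sectorMap U c ξ) = (∏ i, ξ i : ℝ) * F ξ)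
    {ξ : Fin d → ℝ} (hξ : ξ ∈ univ.pi fun _ => Ioc (0 : ℝ) 1) :
    |(LinearMap.toContinuousLinearMap
      (Matrix.toLin' (U * Matrix.diagonal fun i => -(ξ i)⁻¹ / c i))).det| • h (sectorMap U c ξ) =
      ((|U.det| / ∏ i, c i : ℝ) : ℂ) * F ξ := by
  have hpos : (0 : ℝ) < ∏ i, ξ i := Finset.prod_pos fun i _ => (hξ i trivial).1
  rw [hF ξ hξ, abs_det_sectorMap U hc fun i => (hξ i trivial).1, Complex.real_smul, ← mul_assoc,
    ← Complex.ofReal_mul, mul_assoc, inv_mul_cancel₀ hpos.ne', mul_one]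

/-- Integrability over a simplicial cone in the coordinates of the unit cube, for a function with a
factor `∏ i, ξ i` that cancels the Jacobian. -/
lemma integrableOn_cone_iff (hU : U.det ≠ 0) (hc : ∀ i, 0 < c i)
    (hF : ∀ ξ ∈ univ.pi fun _ => Ioc (0 : ℝ) 1, h (sectorMap U c ξ) = (∏ i, ξ i : ℝ) * F ξ) :
    IntegrableOn h {s | ∃ l : Fin d → ℝ, (∀ i, 0 ≤ l i) ∧ s = U.mulVec l} ↔
      IntegrableOn F (Icc 0 1) := by
  rw [← image_sectorMap U hc, integrableOn_image_iff_integrableOn_abs_det_fderiv_smul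
    volume measurableSet_unitCube (fun ξ hξ => (hasFDerivAt_sectorMap U c
      fun i => (hξ i trivial).1).hasFDerivWithinAt) (sectorMap_injOn hU hc),
    integrableOn_congr_fun (fun ξ hξ => abs_det_sectorMap_smul hc hF hξ) measurableSet_unitCube,
    ← integrableOn_congr_set_ae unitCube_ae_eq]
  have hne : ((|U.det| / ∏ i, c i : ℝ) : ℂ) ≠ 0 := by
    rw [Complex.ofReal_ne_zero]
    exact (div_pos (abs_pos.2 hU) (Finset.prod_pos fun i _ => hc i)).ne'
  exact integrable_const_mul_iff hne.isUnit _

lemma integral_cone_eq (hU : U.det ≠ 0) (hc : ∀ i, 0 < c i)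
    (hF : ∀ ξ ∈ univ.pi fun _ => Ioc (0 : ℝ) 1, h (sectorMap U c ξ) = (∏ i, ξ i : ℝ) * F ξ) :
    ∫ s in {s | ∃ l : Fin d → ℝ, (∀ i, 0 ≤ l i) ∧ s = U.mulVec l}, h s =
      ((|U.det| / ∏ i, c i : ℝ) : ℂ) * ∫ ξ in Icc 0 1, F ξ := by
  rw [← image_sectorMap U hc, integral_image_eq_integral_abs_det_fderiv_smul
    volume measurableSet_unitCube (fun ξ hξ => (hasFDerivAt_sectorMap U c
      fun i => (hξ i trivial).1).hasFDerivWithinAt) (sectorMap_injOn hU hc),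
    setIntegral_congr_fun measurableSet_unitCube
      (fun ξ hξ => abs_det_sectorMap_smul hc hF hξ), setIntegral_congr_set unitCube_ae_eq]
  exact integral_const_mul _ _

/-- The cone spanned by the columns of an invertible matrix is measurable. -/
lemma measurableSet_cone (hU : U.det ≠ 0) :
    MeasurableSet {s | ∃ l : Fin d → ℝ, (∀ i, 0 ≤ l i) ∧ s = U.mulVec l} := by
  -- All positive weights give the same image, so `c = 1` loses nothing.
  rw [← image_sectorMap U (c := 1) fun _ => one_pos]
  exact measurable_image_of_fderivWithin measurableSet_unitCube
    (fun ξ hξ => (hasFDerivAt_sectorMap U 1 fun i => (hξ i trivial).1).hasFDerivWithinAt)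
    (sectorMap_injOn hU fun _ => one_pos)

end ChangeOfVariables

/-! ### Maximizers of linear forms and normal cones -/

section Maximizers

variable {n : ℕ}

/-- The linear form `v ↦ ⟨y, v⟩`. -/
def dotForm (y : Fin n → ℝ) : Module.Dual ℝ (Fin n → ℝ) where
  toFun v := y ⬝ᵥ v
  map_add' := dotProduct_add y
  map_smul' c v := dotProduct_smul c y v

@[simp]
lemma dotForm_apply (y v : Fin n → ℝ) : dotForm y v = y ⬝ᵥ v := rfl

lemma isMaximizer_iff {P : Set (Fin n → ℝ)} {y w : Fin n → ℝ} :
    IsMaximizer P y w ↔ w ∈ P ∧ ∀ v ∈ P, y ⬝ᵥ v ≤ y ⬝ᵥ w := by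
  constructor
  · rintro ⟨hw, -, h⟩
    exact ⟨hw, fun v hv => h ⟨v, hv, rfl⟩⟩
  · rintro ⟨hw, h⟩
    refine ⟨hw, ⟨w, hw, rfl⟩, ?_⟩
    rintro _ ⟨v, hv, rfl⟩
    exact h v hv

lemma IsMaximizer.dotProduct_eq {P : Set (Fin n → ℝ)} {y w w' : Fin n → ℝ}
    (h : IsMaximizer P y w) (h' : IsMaximizer P y w') : y ⬝ᵥ w = y ⬝ᵥ w' :=
  h.2.unique h'.2

/-- Adding `c • 𝟙` shifts all values on `P` by the same constant `c * D`, so being a maximizer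
depends only on the class of `y` in `ℝⁿ / 𝟙ℝ`. -/
lemma IsMaximizer.add_smul_one {P : Set (Fin n → ℝ)} {D : ℝ} (hP : ∀ v ∈ P, 1 ⬝ᵥ v = D)
    {y w : Fin n → ℝ} (h : IsMaximizer P y w) (c : ℝ) : IsMaximizer P (y + c • 1) w := by
  rw [isMaximizer_iff] at h ⊢
  refine ⟨h.1, fun v hv => ?_⟩
  simpa [add_dotProduct, hP v hv, hP w h.1] using h.2 v hv

/-- The face of `P` on which a linear form is maximal. -/
lemma IsMaximizer.exists_face {P : Set (Fin n → ℝ)} {y w : Fin n → ℝ} (h : IsMaximizer P y w) :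
    ∃ F, IsFace P F ∧ F.Nonempty ∧ y ∈ normalCone P F := by
  have h' := isMaximizer_iff.1 h
  refine ⟨{v | v ∈ P ∧ dotForm y v = y ⬝ᵥ w}, ⟨dotForm y, y ⬝ᵥ w, h'.2, rfl⟩, ⟨w, h.1, rfl⟩, ?_⟩
  rintro v ⟨hv, hvw⟩
  refine isMaximizer_iff.2 ⟨hv, fun v' hv' => ?_⟩
  rw [dotForm_apply] at hvw
  rw [hvw]
  exact h'.2 v' hv'

lemma sUnion_reducedCommonNormalFan {A B : Set (Fin n → ℝ)}
    (hA : ∀ y, ∃ w, IsMaximizer A y w) (hB : ∀ y, ∃ w, IsMaximizer B y w) :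
    ⋃₀ reducedCommonNormalFan A B = univ := by
  refine eq_univ_of_forall fun x => ?_
  obtain ⟨y, rfl⟩ := toTropProj_surjective x
  obtain ⟨F, hF, hF0, hyF⟩ := (hA y).choose_spec.exists_face
  obtain ⟨G, hG, hG0, hyG⟩ := (hB y).choose_spec.exists_face
  exact ⟨_, ⟨_, ⟨_, ⟨F, hF, hF0, rfl⟩, _, ⟨G, hG, hG0, rfl⟩, rfl⟩, rfl⟩, y, ⟨hyF, hyG⟩, rfl⟩

lemma exists_maximizesOn_of_subset_image {P F : Set (Fin n → ℝ)} {D : ℝ}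
    (hP : ∀ v ∈ P, 1 ⬝ᵥ v = D) (hF : IsFace P F) (hF0 : F.Nonempty) {C : Set (TropProj n)}
    (hC : C ⊆ toTropProj '' normalCone P F) : ∃ w, MaximizesOn C P w := by
  obtain ⟨w, hw⟩ := hF0
  refine ⟨w, ?_, fun y hy => ?_⟩
  · obtain ⟨z, c, -, rfl⟩ := hF
    exact hw.1
  · obtain ⟨y', hy', h⟩ := hC hy
    obtain ⟨c, rfl⟩ := toTropProj_eq_iff.1 h.symm
    exact (hy' w hw).add_smul_one hP c

/-- `C` lies in the image of the intersection of a normal cone of `A` with one of `B`; any points of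
the two corresponding faces serve as maximizers. -/
lemma exists_maximizesOn {A B : Set (Fin n → ℝ)} {D E : ℝ}
    (hA : ∀ y, ∃ w, IsMaximizer A y w) (hB : ∀ y, ∃ w, IsMaximizer B y w)
    (hA1 : ∀ v ∈ A, 1 ⬝ᵥ v = D) (hB1 : ∀ v ∈ B, 1 ⬝ᵥ v = E) {Δ : Set (Set (TropProj n))}
    (hΔ : IsSimplicialRefinement Δ (reducedCommonNormalFan A B)) {C : Set (TropProj n)}
    (hC : C ∈ Δ) : (∃ w, MaximizesOn C A w) ∧ ∃ w, MaximizesOn C B w := by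
  obtain ⟨_, ⟨_, ⟨_, ⟨F, hF, hF0, rfl⟩, _, ⟨G, hG, hG0, rfl⟩, rfl⟩, rfl⟩, hsub⟩ :=
    hΔ.exists_superset (sUnion_reducedCommonNormalFan hA hB) hC
  exact ⟨exists_maximizesOn_of_subset_image hA1 hF hF0
      (hsub.trans (image_mono inter_subset_left)),
    exists_maximizesOn_of_subset_image hB1 hG hG0
      (hsub.trans (image_mono inter_subset_right))⟩

/-- A linear form on a polytope `B` of full dimension in a hyperplane `⟨𝟙, v⟩ = E` is constant on `B`
only if it is proportional to `𝟙`. -/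
lemma toTropProj_eq_zero_of_const {d : ℕ} {B : Set (Fin (d + 1) → ℝ)} {E m : ℝ}
    (hB1 : ∀ v ∈ B, 1 ⬝ᵥ v = E) (R1 : Module.finrank ℝ (vectorSpan ℝ B) = d)
    {y : Fin (d + 1) → ℝ} (hy : ∀ v ∈ B, y ⬝ᵥ v = m) : toTropProj y = 0 := by
  have key : ∀ (z : Fin (d + 1) → ℝ) (e : ℝ), (∀ v ∈ B, z ⬝ᵥ v = e) →
      vectorSpan ℝ B ≤ LinearMap.ker (dotForm z) := by
    intro z e hz
    rw [vectorSpan_def, Submodule.span_le]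
    rintro _ ⟨v, hv, v', hv', rfl⟩
    simp [hz v hv, hz v' hv']
  -- The direction space of `B` lies in the hyperplane orthogonal to `𝟙`, and both have dimension
  -- `d`.
  have h1 : vectorSpan ℝ B = LinearMap.ker (dotForm 1) := by
    refine Submodule.eq_of_le_of_finrank_eq (key 1 E hB1) ?_
    have hne : dotForm (1 : Fin (d + 1) → ℝ) ≠ 0 := fun h => by
      have := LinearMap.congr_fun h (Pi.single 0 1)
      simp at this
    have := Module.Dual.finrank_ker_add_one_of_ne_zero hne
    simp only [Module.finrank_fintype_fun_eq_card, Fintype.card_fin] at this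
    omega
  have h2 := h1 ▸ key y m hy
  have : toTropProj y = toTropProj 0 := by
    refine toTropProj_eq_iff.2 ⟨y 0, funext fun k => ?_⟩
    -- Differences of unit vectors are orthogonal to `𝟙`, so `y` kills them and all its coordinates
    -- agree.
    have hk : (Pi.single k 1 - Pi.single 0 1 : Fin (d + 1) → ℝ) ∈ LinearMap.ker (dotForm y) :=
      h2 (by simp [dotProduct_sub])
    simp only [LinearMap.mem_ker, dotForm_apply, dotProduct_sub, dotProduct_single_one] at hk
    simp only [zero_add, Pi.smul_apply, Pi.one_apply, smul_eq_mul, mul_one]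
    linarith
  simpa [toTropProj] using this

/-- A linear form maximized over a set at a point of the intrinsic interior is constant on the set. -/
lemma dotProduct_eq_of_mem_intrinsicInterior {B : Set (Fin n → ℝ)} {y w : Fin n → ℝ}
    (hw : w ∈ intrinsicInterior ℝ B) (hmax : ∀ v ∈ B, y ⬝ᵥ v ≤ y ⬝ᵥ w) :
    ∀ v ∈ B, y ⬝ᵥ v = y ⬝ᵥ w := by
  intro v hv
  refine le_antisymm (hmax v hv) ?_
  obtain ⟨⟨w', hw'⟩, hint, rfl⟩ := mem_intrinsicInterior.1 hw
  -- The line through `w'` and `v` can be prolonged slightly beyond `w'` inside `B`. Were `⟨y, v⟩ <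
  -- ⟨y, w'⟩`, the form would exceed its maximum there.
  let γ : ℝ → affineSpan ℝ B := fun t =>
    ⟨AffineMap.lineMap w' v t, AffineMap.lineMap_mem t hw' (subset_affineSpan ℝ B hv)⟩
  have hγ : Continuous γ := by
    refine Continuous.subtype_mk ?_ _
    exact AffineMap.lineMap_continuous
  have h0 : γ 0 = ⟨w', hw'⟩ := Subtype.ext (AffineMap.lineMap_apply_zero _ _)
  have hmem : γ ⁻¹' interior ((↑) ⁻¹' B : Set (affineSpan ℝ B)) ∈ nhds 0 :=
    (isOpen_interior.preimage hγ).mem_nhds (by rw [mem_preimage, h0]; exact hint)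
  obtain ⟨ε, hε, hball⟩ := Metric.mem_nhds_iff.1 hmem
  have h1 : γ (-(ε / 2)) ∈ interior ((↑) ⁻¹' B : Set (affineSpan ℝ B)) := hball (by
    rw [Metric.mem_ball, Real.dist_0_eq_abs, abs_neg, abs_of_pos (half_pos hε)]
    exact half_lt_self hε)
  have h2 : y ⬝ᵥ (γ (-(ε / 2)) : Fin n → ℝ) ≤ y ⬝ᵥ w' :=
    hmax _ (interior_subset (s := ((↑) ⁻¹' B : Set (affineSpan ℝ B))) h1)
  simp only [γ, AffineMap.lineMap_apply, vsub_eq_sub, vadd_eq_add, dotProduct_add,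
    dotProduct_smul, dotProduct_sub, smul_eq_mul] at h2
  nlinarith

lemma dotProduct_lt_of_mem_intrinsicInterior {d : ℕ} {B : Set (Fin (d + 1) → ℝ)} {E : ℝ}
    (hB1 : ∀ v ∈ B, 1 ⬝ᵥ v = E) (R1 : Module.finrank ℝ (vectorSpan ℝ B) = d)
    {y wA wB : Fin (d + 1) → ℝ} (hy : toTropProj y ≠ 0) (hA : wA ∈ intrinsicInterior ℝ B)
    (hB : IsMaximizer B y wB) : y ⬝ᵥ wA < y ⬝ᵥ wB := by
  rw [isMaximizer_iff] at hB
  refine lt_of_le_of_ne (hB.2 _ (intrinsicInterior_subset hA)) fun h => hy ?_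
  exact toTropProj_eq_zero_of_const hB1 R1 (dotProduct_eq_of_mem_intrinsicInterior hA (h ▸ hB.2))

end Maximizers

/-! ### Newton polytopes and tropical approximations -/

section Newton

variable {n : ℕ}

/-- A linear form attains its maximum over the convex hull at an exponent of the support, and
exponentiation turns that maximum into the largest monomial. The same `w` therefore serves both
claims. -/
lemma exists_isMaximizer_newtonPolytope {p : MvPolynomial (Fin n) ℂ} (hp : p ≠ 0)
    (y : Fin n → ℝ) : ∃ w, IsMaximizer (newtonPolytope p) y w ∧
      tropicalApprox p (fun k => Real.exp (y k)) = Real.exp (y ⬝ᵥ w) := by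
  obtain ⟨l, hl, hmax⟩ := p.support.exists_max_image
    (fun l : Fin n →₀ ℕ => y ⬝ᵥ fun k => (l k : ℝ)) (MvPolynomial.support_nonempty.2 hp)
  have hexp : ∀ l : Fin n →₀ ℕ,
      ∏ k, Real.exp (y k) ^ l k = Real.exp (y ⬝ᵥ fun k => (l k : ℝ)) := fun l => by
    rw [dotProduct, Real.exp_sum]
    exact Finset.prod_congr rfl fun k _ => by rw [mul_comm, Real.exp_nat_mul]
  refine ⟨fun k => (l k : ℝ), isMaximizer_iff.2 ⟨subset_convexHull ℝ _ ⟨l, hl, rfl⟩, ?_⟩, ?_⟩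
  · refine fun v hv => convexHull_min (t := {v | dotForm y v ≤ y ⬝ᵥ fun k => (l k : ℝ)}) ?_
      (convex_halfSpace_le (dotForm y).isLinear _) hv
    rintro _ ⟨l', hl', rfl⟩
    exact hmax l' hl'
  · refine IsGreatest.csSup_eq ⟨⟨l, hl, hexp l⟩, ?_⟩
    rintro _ ⟨l', hl', rfl⟩
    simp only [hexp]
    exact Real.exp_le_exp.2 (hmax l' hl')

variable {ι : Type*} [Fintype ι] {a : ι → MvPolynomial (Fin n) ℂ} {ν : ι → ℂ}

/-- With non-negative weights, a weighted Minkowski sum is maximized summand by summand. -/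
lemma exists_isMaximizer_weightedNewtonSum (ha₀ : ∀ i, a i ≠ 0) (hν : ∀ i, 0 ≤ (ν i).re)
    (y : Fin n → ℝ) : ∃ w, IsMaximizer (weightedNewtonSum a ν) y w ∧
      ∏ i, tropicalApprox (a i) (fun k => Real.exp (y k)) ^ (ν i).re = Real.exp (y ⬝ᵥ w) := by
  choose v hv htr using fun i => exists_isMaximizer_newtonPolytope (ha₀ i) y
  have hdot : ∀ p : ι → Fin n → ℝ, y ⬝ᵥ (∑ i, (ν i).re • p i) = ∑ i, (ν i).re * (y ⬝ᵥ p i) :=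
    fun p => by simp [dotProduct_sum]
  refine ⟨∑ i, (ν i).re • v i, isMaximizer_iff.2 ⟨⟨v, fun i => (hv i).1, rfl⟩, ?_⟩, ?_⟩
  · rintro _ ⟨p, hp, rfl⟩
    rw [hdot, hdot]
    exact Finset.sum_le_sum fun i _ =>
      mul_le_mul_of_nonneg_left ((isMaximizer_iff.1 (hv i)).2 _ (hp i)) (hν i)
  · rw [hdot, Real.exp_sum]
    exact Finset.prod_congr rfl fun i _ => by rw [htr, ← Real.exp_mul, mul_comm]

lemma IsMaximizer.prod_tropicalApprox (ha₀ : ∀ i, a i ≠ 0) (hν : ∀ i, 0 ≤ (ν i).re)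
    {y w : Fin n → ℝ} (h : IsMaximizer (weightedNewtonSum a ν) y w) :
    ∏ i, tropicalApprox (a i) (fun k => Real.exp (y k)) ^ (ν i).re = Real.exp (y ⬝ᵥ w) := by
  obtain ⟨w', hw', h'⟩ := exists_isMaximizer_weightedNewtonSum ha₀ hν y
  rw [h', h.dotProduct_eq hw']

lemma one_dotProduct_newtonPolytope {p : MvPolynomial (Fin n) ℂ} {D : ℕ} (hp : p.IsHomogeneous D)
    {v : Fin n → ℝ} (hv : v ∈ newtonPolytope p) : 1 ⬝ᵥ v = (D : ℝ) := by
  refine convexHull_min (t := {v | dotForm 1 v = (D : ℝ)}) ?_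
    (convex_hyperplane (dotForm 1).isLinear _) hv
  rintro _ ⟨l, hl, rfl⟩
  have := hp (MvPolynomial.mem_support_iff.1 hl)
  rw [← this]
  simp [Finsupp.weight_apply, Finsupp.sum_fintype, dotProduct]

lemma one_dotProduct_weightedNewtonSum (ha : ∀ i, (a i).IsHomogeneous (a i).totalDegree)
    (v : Fin n → ℝ) (hv : v ∈ weightedNewtonSum a ν) :
    1 ⬝ᵥ v = ∑ i, (ν i).re * (a i).totalDegree := by
  obtain ⟨p, hp, rfl⟩ := hv
  rw [dotProduct_sum]
  exact Finset.sum_congr rfl fun i _ => by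
    rw [dotProduct_smul, one_dotProduct_newtonPolytope (ha i) (hp i), smul_eq_mul]

end Newton

/-! ### Sector parametrization and the tiling by maximal cones -/

section Sectors

variable {d : ℕ} {u : Fin d → Fin (d + 1) → ℝ} {w : Fin (d + 1) → ℝ}

/-- The matrix whose columns are the affine coordinates of the generators of a cone. -/
def coordMatrix (u : Fin d → Fin (d + 1) → ℝ) : Matrix (Fin d) (Fin d) ℝ :=
  Matrix.of fun j i => affineCoord d (u i) j

lemma sectorPrefactor_eq (u : Fin d → Fin (d + 1) → ℝ) (w : Fin (d + 1) → ℝ) :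
    sectorPrefactor u w = |(coordMatrix u).det| / ∏ k, u k ⬝ᵥ w := by
  rw [sectorPrefactor, det_snoc_one, coordMatrix]

lemma det_coordMatrix_ne_zero (hu : LinearIndependent ℝ fun k => toTropProj (u k)) :
    (coordMatrix u).det ≠ 0 := by
  have h : LinearIndependent ℝ (coordMatrix u).col :=
    hu.map' (tropProjEquiv d).toLinearMap (tropProjEquiv d).ker
  rw [Matrix.linearIndependent_cols_iff_isUnit, Matrix.isUnit_iff_isUnit_det] at h
  exact h.ne_zero

lemma affineCoord_sum_smul (u : Fin d → Fin (d + 1) → ℝ) (l : Fin d → ℝ) :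
    affineCoord d (∑ i, l i • u i) = (coordMatrix u).mulVec l := by
  rw [map_sum]
  ext j
  simp only [map_smul, Finset.sum_apply, Pi.smul_apply, smul_eq_mul, Matrix.mulVec, dotProduct,
    coordMatrix, Matrix.of_apply]
  exact Finset.sum_congr rfl fun i _ => mul_comm _ _

lemma image_coneHull (u : Fin d → Fin (d + 1) → ℝ) :
    tropProjEquiv d '' (coneHull fun k => toTropProj (u k)) =
      {s | ∃ l : Fin d → ℝ, (∀ i, 0 ≤ l i) ∧ s = (coordMatrix u).mulVec l} := by
  ext s
  constructor
  · rintro ⟨_, ⟨l, hl, rfl⟩, rfl⟩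
    exact ⟨l, hl, by
      rw [← toTropProj_sum_smul, tropProjEquiv_toTropProj, affineCoord_sum_smul]⟩
  · rintro ⟨l, hl, rfl⟩
    exact ⟨_, ⟨l, hl, rfl⟩, by
      rw [← toTropProj_sum_smul, tropProjEquiv_toTropProj, affineCoord_sum_smul]⟩

lemma sectorPoint_eq_exp {ξ : Fin d → ℝ} (hξ : ∀ i, 0 < ξ i) :
    sectorPoint u w ξ =
      fun k => Real.exp ((∑ i, (-Real.log (ξ i) / (u i ⬝ᵥ w)) • u i) k) := by
  funext k
  rw [sectorPoint, Finset.sum_apply, Real.exp_sum]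
  refine Finset.prod_congr rfl fun i _ => ?_
  rw [Real.rpow_def_of_pos (hξ i), Pi.smul_apply, smul_eq_mul]
  congr 1
  ring

lemma toTropProj_mem_coneHull (hc : ∀ i, 0 < u i ⬝ᵥ w) {ξ : Fin d → ℝ}
    (hξ : ∀ i, 0 < ξ i ∧ ξ i ≤ 1) :
    toTropProj (∑ i, (-Real.log (ξ i) / (u i ⬝ᵥ w)) • u i) ∈
      coneHull fun k => toTropProj (u k) :=
  ⟨_, fun i => div_nonneg (neg_nonneg.2 (Real.log_nonpos (hξ i).1.le (hξ i).2)) (hc i).le,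
    toTropProj_sum_smul _ _⟩

/-- The exponents of `sectorPoint` are divided by `⟨u i, w⟩` precisely so that pairing with `w`
leaves `-∑ log (ξ i)`. -/
lemma exp_neg_dotProduct (hc : ∀ i, 0 < u i ⬝ᵥ w) {ξ : Fin d → ℝ} (hξ : ∀ i, 0 < ξ i) :
    Real.exp (-((∑ i, (-Real.log (ξ i) / (u i ⬝ᵥ w)) • u i) ⬝ᵥ w)) = ∏ i, ξ i := by
  rw [sum_dotProduct, ← Finset.sum_neg_distrib, Real.exp_sum]
  refine Finset.prod_congr rfl fun i _ => ?_
  rw [smul_dotProduct, smul_eq_mul, div_mul_cancel₀ _ (hc i).ne', neg_neg, Real.exp_log (hξ i)]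

/-- The chart picks the representative of the class of `y` whose last coordinate is zero. -/
lemma affineChart_exp_affineCoord (y : Fin (d + 1) → ℝ) :
    affineChart (fun i => Real.exp (affineCoord d y i)) =
      fun k => Real.exp ((y + (-y (Fin.last d)) • 1) k) := by
  funext k
  induction k using Fin.lastCases with
  | last => simp [affineChart]
  | cast i => simp [affineChart, sub_eq_add_neg]

lemma volume_image_eq_zero {W : Submodule ℝ (TropProj (d + 1))} (hW : W ≠ ⊤)
    {T : Set (TropProj (d + 1))} (hT : T ⊆ W) : volume (tropProjEquiv d '' T) = 0 := by
  refine measure_mono_null (image_mono hT)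
    (Measure.addHaar_submodule volume (W.map (tropProjEquiv d).toLinearMap) fun h => hW ?_)
  rw [Submodule.eq_top_iff'] at h ⊢
  intro x
  obtain ⟨x', hx', h'⟩ := h (tropProjEquiv d x)
  rwa [← (tropProjEquiv d).injective h']

variable {Δ : Set (Set (TropProj (d + 1)))}

/-- The maximal cones of a complete fan cover space up to a null set. -/
lemma iUnion_maximalCones_ae_eq (hΔ : IsFan Δ) (hU : ⋃₀ Δ = univ) :
    (⋃ C : maximalCones Δ, tropProjEquiv d '' (C : Set (TropProj (d + 1)))) =ᵐ[volume] univ := by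
  rw [ae_eq_univ]
  refine measure_mono_null (t := ⋃ C ∈ Δ \ maximalCones Δ, tropProjEquiv d '' C) ?_ ?_
  · intro s hs
    obtain ⟨C, hC, hs'⟩ := mem_sUnion.1 (hU ▸ mem_univ ((tropProjEquiv d).symm s))
    have hsC : s ∈ tropProjEquiv d '' C := ⟨_, hs', by simp⟩
    refine mem_biUnion ⟨hC, fun hM => hs ?_⟩ hsC
    exact mem_iUnion.2 ⟨⟨C, hM⟩, hsC⟩
  · refine (measure_biUnion_null_iff hΔ.finite.sdiff.countable).2 fun C hC => ?_
    refine volume_image_eq_zero (W := Submodule.span ℝ C) (fun h => hC.2 ?_) Submodule.subset_span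
    exact (hΔ.mem_maximalCones_iff hU).2 ⟨hC.1, h⟩

/-- Distinct cones of a fan meet inside a proper subspace, which has measure zero. -/
lemma aedisjoint_maximalCones (hΔ : IsFan Δ) :
    Pairwise (Function.onFun (AEDisjoint volume)
      fun C : maximalCones Δ => tropProjEquiv d '' (C : Set (TropProj (d + 1)))) := by
  intro C C' hne
  obtain ⟨W, hW, hsub⟩ := hΔ.exists_inter_subset C.2.1 C'.2.1 fun h => hne (Subtype.ext h)
  rw [Function.onFun, AEDisjoint, ← image_inter (tropProjEquiv d).injective]
  exact volume_image_eq_zero hW hsub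

end Sectors

end TropicalSector

end

/-! ### The sector decomposition -/

open TropicalSector in
theorem theorem4p4 {d : ℕ} {ι κ : Type*} [Fintype ι] [Fintype κ]
    (a : ι → MvPolynomial (Fin (d + 1)) ℂ) (ν : ι → ℂ)
    (b : κ → MvPolynomial (Fin (d + 1)) ℂ) (ρ : κ → ℂ)
    (ha₀ : ∀ i, a i ≠ 0) (hb₀ : ∀ j, b j ≠ 0)
    (ha : ∀ i, (a i).IsHomogeneous (a i).totalDegree)
    (hb : ∀ j, (b j).IsHomogeneous (b j).totalDegree)
    (hν : ∀ i, 0 ≤ (ν i).re) (hρ : ∀ j, 0 ≤ (ρ j).re)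
    (hdeg : ∑ i, ν i * ((a i).totalDegree : ℂ) = ∑ j, ρ j * ((b j).totalDegree : ℂ))
    (A B : Set (Fin (d + 1) → ℝ))
    (hA : A = weightedNewtonSum a ν) (hB : B = weightedNewtonSum b ρ)
    (R1 : Module.finrank ℝ (vectorSpan ℝ B) = d)
    (R2 : A ⊆ intrinsicInterior ℝ B)
    (Δ : Set (Set (TropProj (d + 1))))
    (hΔ : IsSimplicialRefinement Δ (reducedCommonNormalFan A B)) :
    -- generators and maximizers exist for every maximal cone
    (∀ C ∈ maximalCones Δ,
      (∃ u, Generates C u) ∧ (∃ wA, MaximizesOn C A wA) ∧ (∃ wB, MaximizesOn C B wB)) ∧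
    -- and the decomposition holds for every choice of them
    ∀ (u : Set (TropProj (d + 1)) → Fin d → Fin (d + 1) → ℝ)
      (wA wB w : Set (TropProj (d + 1)) → Fin (d + 1) → ℝ),
      (∀ C ∈ maximalCones Δ, Generates C (u C)) →
      (∀ C ∈ maximalCones Δ, MaximizesOn C A (wA C)) →
      (∀ C ∈ maximalCones Δ, MaximizesOn C B (wB C)) →
      (∀ C ∈ maximalCones Δ, w C = wB C - wA C) →
      (∀ C ∈ maximalCones Δ, 0 < sectorPrefactor (u C) (w C)) ∧
      (∀ C ∈ maximalCones Δ, ∀ ξ : Fin d → ℝ, (∀ i, 0 < ξ i ∧ ξ i ≤ 1) →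
        sectorPoint (u C) (w C) ξ ∈ expCone C) ∧
      ∀ f : (Fin (d + 1) → ℝ) → ℂ, IsMeasurableHomogeneous f →
        (ProjIntegrable (fun x => (tropicalIntegrand a ν b ρ x : ℂ) * f x) ↔
          ∀ C ∈ maximalCones Δ,
            IntegrableOn (fun ξ => f (sectorPoint (u C) (w C) ξ))
              (Set.Icc (0 : Fin d → ℝ) 1) volume) ∧
        (ProjIntegrable (fun x => (tropicalIntegrand a ν b ρ x : ℂ) * f x) →
          projIntegral (fun x => (tropicalIntegrand a ν b ρ x : ℂ) * f x) =
            ∑ᶠ C ∈ maximalCones Δ,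
              (sectorPrefactor (u C) (w C) : ℂ) *
                ∫ ξ in Set.Icc (0 : Fin d → ℝ) 1, f (sectorPoint (u C) (w C) ξ)) := by
  subst hA hB
  have hA1 := one_dotProduct_weightedNewtonSum (ν := ν) ha
  have hB1 := one_dotProduct_weightedNewtonSum (ν := ρ) hb
  have hAm : ∀ y, ∃ w, IsMaximizer (weightedNewtonSum a ν) y w := fun y =>
    (exists_isMaximizer_weightedNewtonSum ha₀ hν y).imp fun _ h => h.1
  have hBm : ∀ y, ∃ w, IsMaximizer (weightedNewtonSum b ρ) y w := fun y =>
    (exists_isMaximizer_weightedNewtonSum hb₀ hρ y).imp fun _ h => h.1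
  have hU : ⋃₀ Δ = univ := hΔ.sUnion_eq_univ (sUnion_reducedCommonNormalFan hAm hBm)
  refine ⟨fun C hC => ⟨?_, exists_maximizesOn hAm hBm hA1 hB1 hΔ hC.1⟩, ?_⟩
  · obtain ⟨v, rfl⟩ := exists_generators_of_span_eq_top finrank_tropProj (hΔ.simplicial C hC.1)
      ((hΔ.fan.mem_maximalCones_iff hU).1 hC).2
    choose u hu using fun k => toTropProj_surjective (v k)
    exact ⟨u, by rw [Generates]; simp only [hu]⟩
  intro u wA wB w hu hwA hwB hw
  have hli : ∀ C ∈ maximalCones Δ, LinearIndependent ℝ fun k => toTropProj (u C k) :=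
    fun C hC => linearIndependent_of_span_coneHull finrank_tropProj
      ((hu C hC) ▸ ((hΔ.fan.mem_maximalCones_iff hU).1 hC).2)
  -- Each generator has non-zero class and lies in `C`, where `wB C` maximizes over `B`, while `wA
  -- C` is a relative interior point of `B`; the inequality is strict.
  have hc : ∀ C ∈ maximalCones Δ, ∀ k, 0 < u C k ⬝ᵥ w C := by
    intro C hC k
    rw [hw C hC, dotProduct_sub, sub_pos]
    refine dotProduct_lt_of_mem_intrinsicInterior hB1 R1 ((hli C hC).ne_zero k)
      (R2 (hwA C hC).1) ((hwB C hC).2 _ ?_)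
    exact (hu C hC).ge (mem_coneHull_self (fun k => toTropProj (u C k)) k)
  have hdet : ∀ C ∈ maximalCones Δ, (coordMatrix (u C)).det ≠ 0 := fun C hC =>
    det_coordMatrix_ne_zero (hli C hC)
  have himg : ∀ C ∈ maximalCones Δ, tropProjEquiv d '' C =
      {s | ∃ l : Fin d → ℝ, (∀ i, 0 ≤ l i) ∧ s = (coordMatrix (u C)).mulVec l} := fun C hC => by
    conv_lhs => rw [hu C hC]
    exact image_coneHull (u C)
  refine ⟨fun C hC => ?_, fun C hC ξ hξ => ?_, fun f hf => ?_⟩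
  · rw [sectorPrefactor_eq]
    exact div_pos (abs_pos.2 (hdet C hC)) (Finset.prod_pos fun k _ => hc C hC k)
  · refine ⟨_, ?_, sectorPoint_eq_exp fun i => (hξ i).1⟩
    have := toTropProj_mem_coneHull (hc C hC) hξ
    rwa [← hu C hC] at this
  set h : (Fin d → ℝ) → ℂ := fun s =>
    (tropicalIntegrand a ν b ρ (affineChart fun i => Real.exp (s i)) : ℂ) *
      f (affineChart fun i => Real.exp (s i)) with hdef
  -- On a sector the tropical factor equals `∏ i, ξ i`, the factor needed to cancel the Jacobian.
  have hF : ∀ C ∈ maximalCones Δ, ∀ ξ ∈ univ.pi fun _ : Fin d => Ioc (0 : ℝ) 1,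
      h (sectorMap (coordMatrix (u C)) (fun i => u C i ⬝ᵥ w C) ξ) =
        (∏ i, ξ i : ℝ) * f (sectorPoint (u C) (w C) ξ) := by
    intro C hC ξ hξ
    -- Both maximizers lie in `B`, hence in one hyperplane orthogonal to `𝟙`.
    have hw1 : 1 ⬝ᵥ w C = 0 := by
      rw [hw C hC, dotProduct_sub, hB1 _ (hwB C hC).1,
        hB1 _ (intrinsicInterior_subset (R2 (hwA C hC).1)), sub_self]
    have hmem := toTropProj_mem_coneHull (hc C hC) fun i => hξ i trivial
    rw [← exp_neg_dotProduct (hc C hC) fun i => (hξ i trivial).1,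
      sectorPoint_eq_exp fun i => (hξ i trivial).1, hdef, sectorMap, ← affineCoord_sum_smul]
    rw [← hu C hC] at hmem
    set y := ∑ i, (-Real.log (ξ i) / (u C i ⬝ᵥ w C)) • u C i
    -- The chart replaces `y` by `y - y_n 𝟙`: the maximizers persist, `⟨·, w C⟩` is unchanged since
    -- `w C` is orthogonal to `𝟙`, and `f` is unchanged by homogeneity of degree `0`.
    have hA' := ((hwA C hC).2 y hmem).add_smul_one hA1 (-y (Fin.last d))
    have hB' := ((hwB C hC).2 y hmem).add_smul_one hB1 (-y (Fin.last d))
    simp only [affineChart_exp_affineCoord]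
    congr 1
    · congr 1
      rw [tropicalIntegrand, hA'.prod_tropicalApprox ha₀ hν, hB'.prod_tropicalApprox hb₀ hρ,
        ← Real.exp_sub, ← neg_sub, ← dotProduct_sub, ← hw C hC, add_dotProduct, smul_dotProduct,
        hw1, smul_zero, add_zero]
    · rw [← hf.homogeneous (fun k => Real.exp (y k)) (fun k => Real.exp_pos _)
        (Real.exp (-y (Fin.last d))) (Real.exp_pos _)]
      congr 1
      funext k
      simp [Real.exp_add, mul_comm]
  have hae := iUnion_maximalCones_ae_eq hΔ.fan hU
  have hfin : Finite (maximalCones Δ) := (hΔ.fan.finite.subset fun C hC => hC.1).to_subtype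
  rw [projIntegrable_iff, projIntegral_eq]
  refine ⟨?_, fun hint => ?_⟩
  · rw [← integrableOn_univ, ← integrableOn_congr_set_ae hae, integrableOn_finite_iUnion,
      Subtype.forall]
    refine forall₂_congr fun C hC => ?_
    simp only [himg C hC]
    exact integrableOn_cone_iff (hdet C hC) (hc C hC) (hF C hC)
  · rw [← setIntegral_univ, ← setIntegral_congr_set hae, integral_iUnion_ae
      (fun C => ?_) (aedisjoint_maximalCones hΔ.fan) hint.integrableOn,
      tsum_eq_finsum (Set.toFinite _), ← finsum_set_coe_eq_finsum_mem (maximalCones Δ)]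
    · refine finsum_congr fun C => ?_
      rw [himg C C.2, sectorPrefactor_eq]
      exact integral_cone_eq (hdet C C.2) (hc C C.2) (hF C C.2)
    · rw [himg C C.2]
      exact (measurableSet_cone (hdet C C.2)).nullMeasurableSet
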